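/- Let $N\ge 2$ and let $\Omega\subset\mathbb R^N$ be a bounded domain (nonempty, open, connected) with Lipschitz boundary. Let $\mathscr C$ be the set of all $p\in C(\overline\Omega)$ such that $1<\inf_\Omega p\le\sup_\Omega p<N$ and such that, for some $L>0$, $$|p(x)-p(y)|\le-\frac{L}{\log|x-y|}\qquad\text{for all }x,y\in\Omega\text{ with }0<|x-y|\le\tfrac12 .$$ For $p\in\mathscr C$ and a measurable (scalar or vector valued) function $u$ on $\Omega$ let $\varrho_{p(x)}(u)=\int_\Omega|u(x)|^{p(x)}\,dx$; let $L^{p(x)}(\Omega)$ be the space of all $u$ with $\varrho_{p(x)}(u)<\infty$, with the Luxemburg norm $\|u\|_{p(x)}=\inf\{\gamma>0:\varrho_{p(x)}(u/\gamma)\le1\}$. Let $W^{1,p(x)}(\Omega)$ be the space of all $u\in L^{p(x)}(\Omega)$ whose distributional gradient $\nabla u$ is in $L^{p(x)}(\Omega)$, with the norm $\|u\|_{p(x)}+\|\nabla u\|_{p(x)}$, and let $W^{1,p(x)}_0(\Omega)$ be the closure of $C_c^\infty(\Omega)$ in it. For an integer $m\ge1$ put $$\lambda^{(m)}_{p(x)}:=\inf_{K\in\mathcal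 W^{(m)}_{p(x)}}\ \sup_{u\in K}\|\nabla u\|_{p(x)},$$ where $\mathcal W^{(m)}_{p(x)}$ is the family of all compact sets $K\subset\{u\in W^{1,p(x)}_0(\Omega):\|u\|_{p(x)}=1\}$ (in the norm topology of $W^{1,p(x)}_0(\Omega)$) with $K=-K$ and $i(K)\ge m$. Here $i(K)$ is the Krasnosel'skiĭ genus of $K$, that is, the least integer $k\ge 0$ for which there is an odd continuous map $K\to\mathbb R^k\setminus\{0\}$, and $i(K)=\infty$ if there is no such $k$. (The infimum is taken in $[0,\infty]$.) Let $m\ge1$, let $p\in\mathscr C$, and let $(p_h)_{h\in\mathbb N}$ be a sequence in $\mathscr C$ such that, for some $\bar h\ge1$, $$\sup_{h\ge\bar h}\sup_\Omega p_h<\frac{N p_I}{N-p_I},\qquad p_I:=\inf_{h\ge\bar h}\inf_\Omega p_h .$$ Suppose that $p_h\to p$ uniformly in $\Omega$ and that $p(x)\le p_h(x)$ for all $h\in\mathbb N$ and $x\in\Omega$. Then $$\lambda^{(m)}_{p_h(x)}\to\lambda^{(m)}_{p(x)}\qquad\text{as }h\to\infty .$$ -/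

import Mathlib

noncomputable section

open MeasureTheory Filter Topology Set TopologicalSpace
open scoped ENNReal ContDiff RealInnerProductSpace

namespace VarExp

/-- `ℝ^N` with its Euclidean norm. -/
abbrev Euc (N : ℕ) : Type := EuclideanSpace ℝ (Fin N)

/-- The open set `Ω` has Lipschitz boundary: near each of its boundary points `x`, up to a rotation
(the vertical direction being the unit vector `ν`), `Ω` is the strict epigraph of a Lipschitz
function on the hyperplane orthogonal to `ν`. -/
def HasLipschitzBoundary {N : ℕ} (Ω : Opens (Euc N)) : Prop :=
  ∀ x ∈ frontier (Ω : Set (Euc N)), ∃ r > 0, ∃ ν : Euc N, ‖ν‖ = 1 ∧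
    ∃ (C : NNReal) (γ : (ℝ ∙ ν)ᗮ → ℝ), LipschitzWith C γ ∧
      ∀ y ∈ Metric.ball x r, y ∈ Ω ↔ γ ((ℝ ∙ ν)ᗮ.orthogonalProjectionOnto y) < ⟪ν, y⟫

/-- Admissible variable exponents on `Ω`: continuous on `closure Ω`, with
`1 < inf_Ω p`, `sup_Ω p < N`, and log-Hölder continuous on `Ω`. -/
structure Exponent {N : ℕ} (Ω : Opens (Euc N)) where
  toFun : Euc N → ℝ
  continuousOn : ContinuousOn toFun (closure (Ω : Set (Euc N)))
  one_lt_inf : ∃ a : ℝ, 1 < a ∧ ∀ x ∈ Ω, a ≤ toFun x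
  sup_lt_dim : ∃ b : ℝ, b < N ∧ ∀ x ∈ Ω, toFun x ≤ b
  logHolder : ∃ L : ℝ, 0 < L ∧ ∀ x ∈ Ω, ∀ y ∈ Ω, 0 < dist x y → dist x y ≤ 1 / 2 →
    |toFun x - toFun y| ≤ -(L / Real.log (dist x y))

instance {N : ℕ} (Ω : Opens (Euc N)) : CoeFun (Exponent Ω) (fun _ => Euc N → ℝ) :=
  ⟨Exponent.toFun⟩

/-- The class `𝒮` of sequences of admissible exponents: for some `k ≥ 1`,
`sup_{h ≥ k} sup_Ω p_h < N p_I / (N - p_I)`, where `p_I = inf_{h ≥ k} inf_Ω p_h`. -/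
def IsSubcriticalSeq {N : ℕ} {Ω : Opens (Euc N)} (p : ℕ → Exponent Ω) : Prop :=
  ∃ k : ℕ, 1 ≤ k ∧
    let range : Set ℝ := {t | ∃ h, k ≤ h ∧ ∃ x ∈ Ω, t = p h x}
    let pI : ℝ := sInf range
    sSup range < N * pI / (N - pI)

section Luxemburg

variable {V : Type*} [AddCommGroup V] [Module ℝ V] [Norm V]

/-- The Luxemburg functional of a finite, convex, even, definite modular is a norm. -/
theorem luxemburg_core (ρ : V → ℝ≥0∞)
    (hconv : ∀ (u v : V) (a b : ℝ), 0 ≤ a → 0 ≤ b → a + b = 1 →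
      ρ (a • u + b • v) ≤ ENNReal.ofReal a * ρ u + ENNReal.ofReal b * ρ v)
    (hsmul : ∀ (u : V) (a : ℝ), |a| ≤ 1 → ρ (a • u) ≤ ENNReal.ofReal |a| * ρ u)
    (hfin : ∀ u, ρ u < (⊤ : ℝ≥0∞)) (hdef : ∀ u, ρ u = 0 → u = 0)
    (hnorm : ∀ u : V, ‖u‖ = sInf {c : ℝ | 0 < c ∧ ρ (c⁻¹ • u) ≤ 1}) :
    NormedSpace.Core ℝ V := by
  have hg : ∀ u : V, ‖u‖ = gauge {v | ρ v ≤ 1} u := by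
    intro u
    rw [gauge_def', hnorm]
    rfl
  have hbal : Balanced ℝ {v | ρ v ≤ 1} := by
    rintro a ha _ ⟨v, hv, rfl⟩
    exact (hsmul v a ha).trans (mul_le_one' (ENNReal.ofReal_le_one.2 ha) hv)
  have hcvx : Convex ℝ {v | ρ v ≤ 1} := by
    intro u hu v hv a b ha hb hab
    refine (hconv u v a b ha hb hab).trans ?_
    calc _ ≤ ENNReal.ofReal a * 1 + ENNReal.ofReal b * 1 := by gcongr <;> assumption
      _ = 1 := by rw [mul_one, mul_one, ← ENNReal.ofReal_add ha hb, hab, ENNReal.ofReal_one]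
  have habs : Absorbent ℝ {v | ρ v ≤ 1} := by
    refine absorbent_iff_eventually_nhdsNE_zero.2 fun u => ?_
    have hlim : Tendsto (fun a : ℝ => ENNReal.ofReal |a| * ρ u) (𝓝 0) (𝓝 0) := by
      have h1 : Tendsto (fun a : ℝ => ENNReal.ofReal |a|) (𝓝 0) (𝓝 0) := by
        have := (ENNReal.continuous_ofReal.comp continuous_abs).tendsto (0 : ℝ)
        simpa [Function.comp_def] using this
      simpa using ENNReal.Tendsto.mul_const h1 (Or.inr (hfin u).ne)
    refine nhdsWithin_le_nhds ?_
    filter_upwards [hlim.eventually_le_const zero_lt_one,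
      Metric.closedBall_mem_nhds (0 : ℝ) zero_lt_one] with a ha ha'
    exact (hsmul u a (by simpa using ha')).trans ha
  refine
    { norm_nonneg := fun u => by rw [hg]; exact gauge_nonneg u
      norm_smul := fun a u => by rw [hg, hg]; exact gauge_smul hbal a u
      norm_triangle := fun u v => by simp only [hg]; exact gauge_add_le hcvx habs u v
      norm_eq_zero_iff := fun u => ⟨fun h => ?_, fun h => by rw [h, hg, gauge_zero]⟩ }
  have key : ∀ ε : ℝ, 0 < ε → ε ≤ 1 → ρ u ≤ ENNReal.ofReal ε := by
    intro ε hε hε1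
    rw [hg] at h
    obtain ⟨c, hc, hcε, v, hv, rfl⟩ := exists_lt_of_gauge_lt habs (h.trans_lt hε)
    have hc1 : |c| ≤ 1 := by rw [abs_of_pos hc]; exact hcε.le.trans hε1
    have h2 := hsmul v c hc1
    rw [abs_of_pos hc] at h2
    calc _ ≤ _ := h2
      _ ≤ ENNReal.ofReal ε * 1 := mul_le_mul' (ENNReal.ofReal_le_ofReal hcε.le) hv
      _ = _ := mul_one _
  refine hdef u (le_antisymm ?_ bot_le)
  have hl : Tendsto ENNReal.ofReal (𝓝[>] 0) (𝓝 0) := by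
    have := (ENNReal.continuous_ofReal.tendsto (0 : ℝ)).mono_left
      (nhdsWithin_le_nhds (s := Ioi 0))
    simpa using this
  refine ge_of_tendsto hl ?_
  filter_upwards [Ioc_mem_nhdsGT zero_lt_one] with ε hε using key ε hε.1 hε.2

end Luxemburg

section Lebesgue

variable {N : ℕ} {Ω : Opens (Euc N)} (p : Exponent Ω)
variable {F : Type*} [NormedAddCommGroup F]

/-- The modular `∫_Ω |u(x)|^{p(x)} dx`, for (classes of) measurable functions on `Ω` with values in
`F` (`F = ℝ` for functions, `F = ℝ^N` for gradients). -/
def modular (u : Euc N →ₘ[volume.restrict (Ω : Set (Euc N))] F) : ℝ≥0∞ :=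
  ∫⁻ x in (Ω : Set (Euc N)), ‖u x‖ₑ ^ p x

theorem Exponent.ae_one_le : ∀ᵐ x ∂(volume.restrict (Ω : Set (Euc N))), 1 ≤ p x := by
  obtain ⟨a, ha, h⟩ := p.one_lt_inf
  exact (ae_restrict_mem Ω.isOpen.measurableSet).mono fun x hx => ha.le.trans (h x hx)

theorem Exponent.ae_le : ∀ᵐ x ∂(volume.restrict (Ω : Set (Euc N))), p x ≤ N := by
  obtain ⟨a, ha, h⟩ := p.sup_lt_dim
  exact (ae_restrict_mem Ω.isOpen.measurableSet).mono fun x hx => (h x hx).trans ha.le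

theorem aemeasurable_rpow (u : Euc N →ₘ[volume.restrict (Ω : Set (Euc N))] F) :
    AEMeasurable (fun x => ‖u x‖ₑ ^ p x) (volume.restrict (Ω : Set (Euc N))) :=
  u.aestronglyMeasurable.enorm.pow
    ((p.continuousOn.mono subset_closure).aemeasurable Ω.isOpen.measurableSet)

theorem modular_zero :
    modular p (0 : Euc N →ₘ[volume.restrict (Ω : Set (Euc N))] F) = 0 := by
  unfold modular
  rw [lintegral_eq_zero_iff' (aemeasurable_rpow p _)]
  filter_upwards [p.ae_one_le, AEEqFun.coeFn_zero (β := F)] with x hp h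
  rw [h]
  simp [zero_lt_one.trans_le hp]

theorem modular_eq_zero {u : Euc N →ₘ[volume.restrict (Ω : Set (Euc N))] F}
    (hu : modular p u = 0) : u = 0 := by
  unfold modular at hu
  rw [lintegral_eq_zero_iff' (aemeasurable_rpow p _)] at hu
  apply AEEqFun.ext
  filter_upwards [p.ae_one_le, AEEqFun.coeFn_zero (β := F), hu] with x hp h h'
  rw [h]
  have := (ENNReal.rpow_eq_zero_iff_of_pos (zero_lt_one.trans_le hp)).1 h'
  simpa using this

variable [NormedSpace ℝ F]

theorem modular_convex (u v : Euc N →ₘ[volume.restrict (Ω : Set (Euc N))] F) {a b : ℝ}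
    (ha : 0 ≤ a) (hb : 0 ≤ b) (hab : a + b = 1) :
    modular p (a • u + b • v) ≤
      ENNReal.ofReal a * modular p u + ENNReal.ofReal b * modular p v := by
  unfold modular
  rw [← lintegral_const_mul'' _ (aemeasurable_rpow p u),
    ← lintegral_const_mul'' _ (aemeasurable_rpow p v),
    ← lintegral_add_left' ((aemeasurable_rpow p u).const_mul _)]
  apply lintegral_mono_ae
  filter_upwards [p.ae_one_le, AEEqFun.coeFn_add (a • u) (b • v), AEEqFun.coeFn_smul a u,
    AEEqFun.coeFn_smul b v] with x hp h1 h2 h3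
  rw [h1, Pi.add_apply, h2, h3, Pi.smul_apply, Pi.smul_apply]
  refine le_trans ?_ (ENNReal.rpow_arith_mean_le_arith_mean2_rpow _ _ _ _ ?_ hp)
  · refine ENNReal.rpow_le_rpow ((enorm_add_le _ _).trans_eq ?_) (zero_le_one.trans hp)
    rw [enorm_smul, enorm_smul, Real.enorm_of_nonneg ha, Real.enorm_of_nonneg hb]
  · rw [← ENNReal.ofReal_add ha hb, hab, ENNReal.ofReal_one]

theorem modular_smul_le (u : Euc N →ₘ[volume.restrict (Ω : Set (Euc N))] F) {a : ℝ}
    (ha : |a| ≤ 1) : modular p (a • u) ≤ ENNReal.ofReal |a| * modular p u := by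
  have h := modular_convex p u 0 (abs_nonneg a) (sub_nonneg.2 ha) (by ring)
  rw [modular_zero, mul_zero, add_zero, smul_zero, add_zero] at h
  refine le_trans (le_of_eq ?_) h
  refine lintegral_congr_ae ?_
  filter_upwards [AEEqFun.coeFn_smul a u, AEEqFun.coeFn_smul |a| u] with x h1 h2
  rw [h1, h2, Pi.smul_apply, Pi.smul_apply, enorm_smul, enorm_smul,
    Real.enorm_eq_ofReal_abs a, Real.enorm_eq_ofReal_abs |a|, abs_abs]

theorem modular_smul_lt_top {u : Euc N →ₘ[volume.restrict (Ω : Set (Euc N))] F} (a : ℝ)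
    (hu : modular p u < (⊤ : ℝ≥0∞)) : modular p (a • u) < (⊤ : ℝ≥0∞) := by
  have h : modular p (a • u) ≤ (1 + ‖a‖ₑ) ^ (N : ℝ) * modular p u := by
    unfold modular
    rw [← lintegral_const_mul'' _ (aemeasurable_rpow p u)]
    apply lintegral_mono_ae
    filter_upwards [p.ae_one_le, p.ae_le, AEEqFun.coeFn_smul a u] with x hp hp' h1
    rw [h1, Pi.smul_apply, enorm_smul, ENNReal.mul_rpow_of_nonneg _ _ (zero_le_one.trans hp)]
    gcongr
    calc ‖a‖ₑ ^ p x ≤ (1 + ‖a‖ₑ) ^ p x :=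
          ENNReal.rpow_le_rpow le_add_self (zero_le_one.trans hp)
      _ ≤ (1 + ‖a‖ₑ) ^ (N : ℝ) := ENNReal.rpow_le_rpow_of_exponent_le le_self_add hp'
  refine h.trans_lt (ENNReal.mul_lt_top ?_ hu)
  exact ENNReal.rpow_lt_top_of_nonneg (Nat.cast_nonneg N) (by simp)

variable (F)

/-- The variable exponent Lebesgue space `L^{p(x)}(Ω)` of `F`-valued functions. -/
def VarLp : Submodule ℝ (Euc N →ₘ[volume.restrict (Ω : Set (Euc N))] F) where
  carrier := {u | modular p u < (⊤ : ℝ≥0∞)}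
  zero_mem' := by
    change modular p 0 < (⊤ : ℝ≥0∞)
    rw [modular_zero]
    exact ENNReal.zero_lt_top
  add_mem' := by
    intro u v hu hv
    have h := modular_convex p ((2 : ℝ) • u) ((2 : ℝ) • v)
      (show (0 : ℝ) ≤ 1 / 2 by norm_num) (show (0 : ℝ) ≤ 1 / 2 by norm_num) (by norm_num)
    rw [smul_smul, smul_smul, show (1 / 2 : ℝ) * 2 = 1 by norm_num, one_smul, one_smul] at h
    exact h.trans_lt (ENNReal.add_lt_top.2
      ⟨ENNReal.mul_lt_top ENNReal.ofReal_lt_top (modular_smul_lt_top p 2 hu),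
        ENNReal.mul_lt_top ENNReal.ofReal_lt_top (modular_smul_lt_top p 2 hv)⟩)
  smul_mem' := fun a _ hu => modular_smul_lt_top p a hu

variable {F}

/-- The Luxemburg norm `inf {γ > 0 : ∫_Ω |u/γ|^{p(x)} dx ≤ 1}`. -/
instance VarLp.instNorm : Norm (VarLp p F) where
  norm u := sInf {c : ℝ | 0 < c ∧
    modular p (c⁻¹ • (u : Euc N →ₘ[volume.restrict (Ω : Set (Euc N))] F)) ≤ 1}

theorem VarLp.core : NormedSpace.Core ℝ (VarLp p F) :=
  luxemburg_core
    (fun u : VarLp p F => modular p (u : Euc N →ₘ[volume.restrict (Ω : Set (Euc N))] F))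
    (fun u v _ _ ha hb hab => modular_convex p u.1 v.1 ha hb hab)
    (fun u _ ha => modular_smul_le p u.1 ha)
    (fun u => u.2)
    (fun _ hu => Subtype.ext (modular_eq_zero p hu))
    (fun _ => rfl)

instance VarLp.instNormedAddCommGroup : NormedAddCommGroup (VarLp p F) :=
  NormedAddCommGroup.ofCore (VarLp.core p)

instance VarLp.instNormedSpace : NormedSpace ℝ (VarLp p F) :=
  NormedSpace.ofCore (VarLp.core p)

end Lebesgue

section Sobolev

variable {N : ℕ} {Ω : Opens (Euc N)}

/-- `φ ∈ C_c^∞(Ω)`. -/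
structure IsTestFunction (Ω : Opens (Euc N)) (φ : Euc N → ℝ) : Prop where
  smooth : ContDiff ℝ ∞ φ
  compact : HasCompactSupport φ
  supp : tsupport φ ⊆ (Ω : Set (Euc N))

/-- `G` is the distributional gradient of `u` in `Ω`. -/
def IsWeakGradient (Ω : Opens (Euc N)) (u : Euc N → ℝ) (G : Euc N → Euc N) : Prop :=
  ∀ φ : Euc N → ℝ, IsTestFunction Ω φ → ∀ v : Euc N,
    ∫ x in (Ω : Set (Euc N)), u x * fderiv ℝ φ x v =
      -∫ x in (Ω : Set (Euc N)), ⟪G x, v⟫ * φ x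

/-- Pairs `(u, G)` with `u ∈ L^{p(x)}(Ω)`, `G ∈ L^{p(x)}(Ω; ℝ^N)`, normed by
`‖u‖_{p(x)} + ‖G‖_{p(x)}`. A Sobolev function `u` is represented by the pair `(u, ∇u)`. -/
abbrev LpPair (p : Exponent Ω) : Type := WithLp 1 (VarLp p ℝ × VarLp p (Euc N))

/-- The underlying class of functions of `(u, ∇u)`. -/
abbrev LpPair.fn {p : Exponent Ω} (w : LpPair p) :
    Euc N →ₘ[volume.restrict (Ω : Set (Euc N))] ℝ := w.fst

/-- The underlying class of vector fields of `(u, ∇u)`. -/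
abbrev LpPair.grad {p : Exponent Ω} (w : LpPair p) :
    Euc N →ₘ[volume.restrict (Ω : Set (Euc N))] Euc N := w.snd

/-- The variable exponent Sobolev space `W^{1,p(x)}(Ω)`, with norm `‖u‖_{p(x)} + ‖∇u‖_{p(x)}`. -/
def sobolev (p : Exponent Ω) : Set (LpPair p) :=
  {w | IsWeakGradient Ω w.fn w.grad}

/-- `W_0^{1,p(x)}(Ω)`, the closure of `C_c^∞(Ω)` in `W^{1,p(x)}(Ω)`. -/
def sobolevZero (p : Exponent Ω) : Set (LpPair p) :=
  sobolev p ∩ closure {w | w ∈ sobolev p ∧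
    ∃ φ, IsTestFunction Ω φ ∧ w.fn =ᵐ[volume.restrict (Ω : Set (Euc N))] φ}

end Sobolev

/-- The Krasnosel'skii genus of a symmetric set `K`: the least `k` such that there is an odd
continuous map from `K` to `ℝ^k \ {0}`, and `∞` if there is none. -/
def genus {V : Type*} [TopologicalSpace V] [Neg V] (K : Set V) : ℕ∞ :=
  ⨅ (k : ℕ) (_ : ∃ f : V → Euc k, ContinuousOn f K ∧ ∀ u ∈ K, f (-u) = -f u ∧ f u ≠ 0), (k : ℕ∞)

section Eigenvalues

variable {N : ℕ} {Ω : Opens (Euc N)}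

/-- The symmetric compact subsets of `{u ∈ W_0^{1,p(x)}(Ω) : ‖u‖_{p(x)} = 1}` of genus `≥ m`. -/
def minimaxSets (p : Exponent Ω) (m : ℕ) : Set (Set (LpPair p)) :=
  {K | IsCompact K ∧ (∀ u ∈ K, -u ∈ K) ∧ K ⊆ {u | u ∈ sobolevZero p ∧ ‖u.fst‖ = 1} ∧ m ≤ genus K}

/-- The `m`-th variational eigenvalue `inf_K sup_{u ∈ K} ‖∇u‖_{p(x)}`, in `[0, ∞]`. -/
def eigenvalue (p : Exponent Ω) (m : ℕ) : ℝ≥0∞ :=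
  ⨅ K ∈ minimaxSets p m, ⨆ u ∈ K, ENNReal.ofReal ‖u.snd‖

end Eigenvalues

end VarExp

end

/-! Let `p ≤ q` be exponents that are uniformly close. Comparing `t ^ p` with `t ^ q` bounds the
modular of `p` by that of `q` plus a small multiple of `|Ω|`, and the modular of `q` by that of `p`
plus a small multiple of the integral of `|u| ^ s`, for any `s` above the range of `q`. So
`‖u‖_p` is at most about `‖u‖_q`, with the converse as long as `‖u‖_{L^s}` is controlled by
`‖u‖_q`.

By approximating a compact symmetric set by an odd map into a finite-dimensional space of test
functions, which does not lower the genus, the inequality `λ^(m) < a` is witnessed by such a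
finite-dimensional set on which `‖∇u‖ < a ‖u‖`; this condition does not mention the exponent
except through the norms. Along `q → p`, a witness for `p` remains one for `q`, because on a
finite-dimensional space of gradients the `L^s` norm is controlled. A witness for `q` remains one
for `p`, because the Gagliardo–Nirenberg–Sobolev inequality and subcriticality control `‖u‖_{L^s}`
by `‖∇u‖_q`, hence by `a ‖u‖_q`, uniformly in `q`. -/

noncomputable section

open MeasureTheory Filter Topology Set TopologicalSpace
open scoped ENNReal NNReal ContDiff RealInnerProductSpace

namespace VarExp

section Powers

theorem rpow_convexCombination_le (v : ℝ≥0) {a b θ : ℝ} (ha : 0 ≤ a) (hb : 0 ≤ b) (h0 : 0 ≤ θ)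
    (h1 : θ ≤ 1) :
    (v : ℝ≥0∞) ^ ((1 - θ) * a + θ * b) ≤
      ENNReal.ofReal (1 - θ) * (v : ℝ≥0∞) ^ a + ENNReal.ofReal θ * (v : ℝ≥0∞) ^ b := by
  have h1' : 0 ≤ 1 - θ := sub_nonneg.2 h1
  have h := NNReal.geom_mean_le_arith_mean2_weighted (1 - θ).toNNReal θ.toNNReal (v ^ a) (v ^ b)
    (by rw [← Real.toNNReal_add h1' h0, sub_add_cancel, Real.toNNReal_one])
  rw [Real.coe_toNNReal _ h1', Real.coe_toNNReal _ h0, ← NNReal.rpow_mul, ← NNReal.rpow_mul,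
    ← NNReal.rpow_add_of_nonneg _ (by positivity) (by positivity), mul_comm a, mul_comm b] at h
  rw [← ENNReal.coe_rpow_of_nonneg _ ha, ← ENNReal.coe_rpow_of_nonneg _ hb,
    ← ENNReal.coe_rpow_of_nonneg _ (by positivity)]
  exact ENNReal.coe_le_coe.2 h

theorem rpow_le_rpow_add_const (v : ℝ≥0) {r q : ℝ} (hr : 0 ≤ r) (hrq : r ≤ q) (hq : 0 < q) :
    (v : ℝ≥0∞) ^ r ≤ (v : ℝ≥0∞) ^ q + ENNReal.ofReal ((q - r) / q) := by
  have h0 : 0 ≤ (q - r) / q := div_nonneg (sub_nonneg.2 hrq) hq.le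
  have h := rpow_convexCombination_le v hq.le le_rfl h0 ((div_le_one hq).2 (by linarith))
  rw [show (1 - (q - r) / q) * q + (q - r) / q * 0 = r by field_simp; ring, ENNReal.rpow_zero,
    mul_one] at h
  refine h.trans ?_
  gcongr
  exact mul_le_of_le_one_left' (ENNReal.ofReal_le_one.2 (by linarith))

theorem rpow_le_rpow_add_mul_rpow (v : ℝ≥0) {p q s : ℝ} (hp : 0 ≤ p) (hpq : p ≤ q) (hqs : q ≤ s)
    (hps : p < s) :
    (v : ℝ≥0∞) ^ q ≤
      (v : ℝ≥0∞) ^ p + ENNReal.ofReal ((q - p) / (s - p)) * (v : ℝ≥0∞) ^ s := by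
  have hsp : 0 < s - p := sub_pos.2 hps
  have h0 : 0 ≤ (q - p) / (s - p) := div_nonneg (sub_nonneg.2 hpq) hsp.le
  have h := rpow_convexCombination_le v hp (hp.trans hps.le) h0 ((div_le_one hsp).2 (by linarith))
  rw [show (1 - (q - p) / (s - p)) * p + (q - p) / (s - p) * s = q by field_simp; ring] at h
  refine h.trans ?_
  gcongr
  exact mul_le_of_le_one_left' (ENNReal.ofReal_le_one.2 (by linarith))

end Powers

section Modular

variable {N : ℕ} {Ω : Opens (Euc N)} {p q : Exponent Ω} {F : Type*} [NormedAddCommGroup F]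

theorem Exponent.one_le (p : Exponent Ω) {x : Euc N} (hx : x ∈ Ω) : 1 ≤ p x := by
  obtain ⟨a, ha, h⟩ := p.one_lt_inf
  exact ha.le.trans (h x hx)

theorem Exponent.pos (p : Exponent Ω) {x : Euc N} (hx : x ∈ Ω) : 0 < p x :=
  one_pos.trans_le (p.one_le hx)

theorem modular_le_modular_add_volume {δ : ℝ} (hpq : ∀ x ∈ Ω, q x ∈ Icc (p x) (p x + δ))
    (u : Euc N →ₘ[volume.restrict (Ω : Set (Euc N))] F) :
    modular p u ≤ modular q u + ENNReal.ofReal δ * volume (Ω : Set (Euc N)) := by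
  unfold modular
  rw [← setLIntegral_const, ← lintegral_add_right _ measurable_const]
  refine setLIntegral_mono_ae' Ω.isOpen.measurableSet (ae_of_all _ fun x hx => ?_)
  have hδ : q x - p x ≤ δ := by linarith [(hpq x hx).2]
  refine (rpow_le_rpow_add_const _ (p.pos hx).le (hpq x hx).1 (q.pos hx)).trans
    (add_le_add_right (ENNReal.ofReal_le_ofReal ?_) _)
  exact (div_le_self (sub_nonneg.2 (hpq x hx).1) (q.one_le hx)).trans hδ

theorem modular_le_modular_add_eLpNorm {δ S : ℝ} {s : ℝ≥0}
    (hpq : ∀ x ∈ Ω, q x ∈ Icc (p x) (p x + δ)) (hqS : ∀ x ∈ Ω, q x ≤ S) (hSs : S < s)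
    (u : Euc N →ₘ[volume.restrict (Ω : Set (Euc N))] F) :
    modular q u ≤ modular p u + ENNReal.ofReal (δ / (s - S)) *
      eLpNorm u s (volume.restrict Ω) ^ (s : ℝ) := by
  unfold modular
  rcases (Ω : Set (Euc N)).eq_empty_or_nonempty with hΩ | ⟨x₀, hx₀⟩
  · simp [hΩ]
  have hs : s ≠ 0 := by
    rintro rfl
    linarith [q.pos hx₀, hqS x₀ hx₀, NNReal.coe_zero]
  rw [eLpNorm_nnreal_pow_eq_lintegral hs, ← lintegral_const_mul' _ _ ENNReal.ofReal_ne_top,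
    ← lintegral_add_left' (aemeasurable_rpow p u)]
  refine setLIntegral_mono_ae' Ω.isOpen.measurableSet (ae_of_all _ fun x hx => ?_)
  have hpq' := (hpq x hx).1
  have hqs := (hqS x hx).trans_lt hSs
  refine (rpow_le_rpow_add_mul_rpow _ (p.pos hx).le hpq' hqs.le (hpq'.trans_lt hqs)).trans
    (add_le_add_right (mul_le_mul_left (ENNReal.ofReal_le_ofReal ?_) _) _)
  exact div_le_div₀ (by linarith [(hpq x hx).2]) (by linarith [(hpq x hx).2]) (by linarith)
    (by linarith [hqS x hx])

theorem eLpNorm_rpow_le_modular_add_volume {r : ℝ≥0} (hr : r ≠ 0) (hrq : ∀ x ∈ Ω, r ≤ q x)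
    (u : Euc N →ₘ[volume.restrict (Ω : Set (Euc N))] F) :
    eLpNorm u r (volume.restrict Ω) ^ (r : ℝ) ≤ modular q u + volume (Ω : Set (Euc N)) := by
  unfold modular
  rw [eLpNorm_nnreal_pow_eq_lintegral hr, ← setLIntegral_one,
    ← lintegral_add_right _ measurable_const]
  refine setLIntegral_mono_ae' Ω.isOpen.measurableSet (ae_of_all _ fun x hx => ?_)
  refine (rpow_le_rpow_add_const _ r.2 (hrq x hx) (q.pos hx)).trans (add_le_add_right ?_ _)
  exact ENNReal.ofReal_le_one.2 ((div_le_one (q.pos hx)).2 (sub_le_self _ r.2))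

variable [NormedSpace ℝ F]

theorem modular_smul_le_rpow_mul (u : Euc N →ₘ[volume.restrict (Ω : Set (Euc N))] F) {a : ℝ}
    (ha : 1 ≤ a) : modular p (a • u) ≤ ENNReal.ofReal a ^ (N : ℝ) * modular p u := by
  unfold modular
  rw [← lintegral_const_mul'' _ (aemeasurable_rpow p u)]
  apply lintegral_mono_ae
  filter_upwards [p.ae_one_le, p.ae_le, AEEqFun.coeFn_smul a u] with x hp hpN hu
  rw [hu, Pi.smul_apply, enorm_smul, ENNReal.mul_rpow_of_nonneg _ _ (zero_le_one.trans hp),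
    Real.enorm_of_nonneg (zero_le_one.trans ha)]
  gcongr
  exact ENNReal.one_le_ofReal.2 ha

end Modular

section LuxemburgNorm

variable {N : ℕ} {Ω : Opens (Euc N)} {p q : Exponent Ω}
variable {F : Type*} [NormedAddCommGroup F] [NormedSpace ℝ F]

theorem VarLp.norm_def (u : VarLp p F) :
    ‖u‖ = sInf {c : ℝ | 0 < c ∧ modular p (c⁻¹ • u.1) ≤ 1} := rfl

theorem VarLp.norm_le_of_modular_le_one {u : VarLp p F} {c : ℝ} (hc : 0 < c)
    (h : modular p (c⁻¹ • u.1) ≤ 1) : ‖u‖ ≤ c :=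
  csInf_le ⟨0, fun _ hx => hx.1.le⟩ ⟨hc, h⟩

theorem VarLp.exists_lt_modular_le_one {u : VarLp p F} (hu : u ≠ 0) {c : ℝ} (hc : ‖u‖ < c) :
    ∃ d < c, 0 < d ∧ modular p (d⁻¹ • u.1) ≤ 1 := by
  have hne : {c : ℝ | 0 < c ∧ modular p (c⁻¹ • u.1) ≤ 1}.Nonempty := by
    refine nonempty_iff_ne_empty.2 fun h => norm_ne_zero_iff.2 hu ?_
    rw [VarLp.norm_def, h, Real.sInf_empty]
  obtain ⟨d, hd, hdc⟩ := exists_lt_of_csInf_lt hne hc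
  exact ⟨d, hdc, hd⟩

/- Rescaling by `t > 1` multiplies the modular by at most `t ^ N`, so that the modular is
continuous along rays and the infimum defining the Luxemburg norm is attained with equality. -/
theorem VarLp.modular_inv_norm_smul {u : VarLp p F} (hu : u ≠ 0) :
    modular p (‖u‖⁻¹ • u.1) = 1 := by
  have hu0 : 0 < ‖u‖ := norm_pos_iff.2 hu
  have hlim (a : ℝ≥0∞) (ha : a ≠ ⊤) :
      Tendsto (fun t : ℝ => ENNReal.ofReal t ^ (N : ℝ) * a) (𝓝[>] 1) (𝓝 a) := by
    have h : Tendsto (fun t : ℝ => ENNReal.ofReal t ^ (N : ℝ)) (𝓝 1) (𝓝 1) := by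
      have := (ENNReal.continuous_rpow_const (y := N)).comp ENNReal.continuous_ofReal
      simpa [Function.comp_def] using this.tendsto (1 : ℝ)
    simpa using (ENNReal.Tendsto.mul_const h (.inr ha)).mono_left nhdsWithin_le_nhds
  apply le_antisymm
  · refine ge_of_tendsto (hlim 1 ENNReal.one_ne_top) ?_
    filter_upwards [self_mem_nhdsWithin] with t (ht : 1 < t)
    obtain ⟨d, hdt, hd0, hd⟩ := exists_lt_modular_le_one hu (lt_mul_of_one_lt_left hu0 ht)
    have hd1 : 1 ≤ d / ‖u‖ := (one_le_div hu0).2 (norm_le_of_modular_le_one hd0 hd)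
    calc modular p (‖u‖⁻¹ • u.1) = modular p ((d / ‖u‖) • d⁻¹ • u.1) := by
          rw [smul_smul, div_mul_eq_mul_div, mul_inv_cancel₀ hd0.ne', one_div]
      _ ≤ ENNReal.ofReal (d / ‖u‖) ^ (N : ℝ) * modular p (d⁻¹ • u.1) :=
          modular_smul_le_rpow_mul _ hd1
      _ ≤ ENNReal.ofReal t ^ (N : ℝ) * 1 := by
          gcongr
          exact ((div_lt_iff₀ hu0).2 hdt).le
  · have hfin : modular p (‖u‖⁻¹ • u.1) ≠ ⊤ := ((VarLp p F).smul_mem _ u.2).ne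
    refine ge_of_tendsto (hlim _ hfin) ?_
    filter_upwards [self_mem_nhdsWithin] with t (ht : 1 < t)
    have ht0 : 0 < t := one_pos.trans ht
    calc 1 ≤ modular p ((‖u‖ / t)⁻¹ • u.1) := by
          by_contra! h
          exact (div_lt_self hu0 ht).not_ge (norm_le_of_modular_le_one (div_pos hu0 ht0) h.le)
      _ = modular p (t • ‖u‖⁻¹ • u.1) := by rw [smul_smul, inv_div, div_eq_mul_inv]
      _ ≤ ENNReal.ofReal t ^ (N : ℝ) * modular p (‖u‖⁻¹ • u.1) :=
          modular_smul_le_rpow_mul _ ht.le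

theorem VarLp.modular_inv_smul_le {u : VarLp p F} {c : ℝ} (hc : 0 < c) (huc : ‖u‖ ≤ c) :
    modular p (c⁻¹ • u.1) ≤ ENNReal.ofReal (‖u‖ / c) := by
  rcases eq_or_ne u 0 with rfl | hu
  · simp [modular_zero]
  have hu0 : 0 < ‖u‖ := norm_pos_iff.2 hu
  have habs : |‖u‖ / c| = ‖u‖ / c := abs_of_nonneg (by positivity)
  calc modular p (c⁻¹ • u.1) = modular p ((‖u‖ / c) • ‖u‖⁻¹ • u.1) := by
        rw [smul_smul, div_mul_eq_mul_div, mul_inv_cancel₀ hu0.ne', one_div]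
    _ ≤ ENNReal.ofReal |‖u‖ / c| * modular p (‖u‖⁻¹ • u.1) :=
        modular_smul_le p _ (habs.trans_le ((div_le_one hc).2 huc))
    _ = ENNReal.ofReal (‖u‖ / c) := by rw [modular_inv_norm_smul hu, mul_one, habs]

theorem VarLp.one_sub_mul_norm_le {u : VarLp p F} {w : VarLp q F} (huw : u.1 = w.1) {κ : ℝ}
    (hκ : 0 ≤ κ)
    (h : modular p (‖u‖⁻¹ • u.1) ≤ modular q (‖u‖⁻¹ • u.1) + ENNReal.ofReal κ) :
    (1 - κ) * ‖u‖ ≤ ‖w‖ := by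
  rcases eq_or_ne u 0 with rfl | hu
  · simp
  have hu0 : 0 < ‖u‖ := norm_pos_iff.2 hu
  rcases le_total ‖u‖ ‖w‖ with hle | hle
  · exact (mul_le_of_le_one_left hu0.le (by linarith)).trans hle
  have key : ENNReal.ofReal 1 ≤ ENNReal.ofReal (‖w‖ / ‖u‖ + κ) := by
    rw [ENNReal.ofReal_add (by positivity) hκ, ENNReal.ofReal_one, ← modular_inv_norm_smul hu]
    refine h.trans ?_
    gcongr
    rw [huw]
    exact modular_inv_smul_le hu0 hle
  rw [← le_div_iff₀ hu0]
  linarith [(ENNReal.ofReal_le_ofReal_iff (by positivity)).1 key]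

theorem VarLp.eLpNorm_inv_norm_smul {u : VarLp p F} (hu : u ≠ 0) (r : ℝ≥0∞) :
    eLpNorm (‖u‖⁻¹ • u.1 : Euc N →ₘ[volume.restrict (Ω : Set (Euc N))] F) r (volume.restrict Ω) =
      eLpNorm u.1 r (volume.restrict Ω) / ‖u‖ₑ := by
  rw [eLpNorm_congr_ae (AEEqFun.coeFn_smul _ _), eLpNorm_const_smul,
    enorm_inv (norm_ne_zero_iff.2 hu), enorm_norm, mul_comm, div_eq_mul_inv]

theorem VarLp.eLpNorm_le {r : ℝ≥0} (hr : r ≠ 0) (hrp : ∀ x ∈ Ω, r ≤ p x) (u : VarLp p F) :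
    eLpNorm u.1 r (volume.restrict (Ω : Set (Euc N))) ≤
      (1 + volume (Ω : Set (Euc N))) ^ (r : ℝ)⁻¹ * ‖u‖ₑ := by
  rcases eq_or_ne u 0 with rfl | hu
  · simp [eLpNorm_congr_ae AEEqFun.coeFn_zero]
  have h := eLpNorm_rpow_le_modular_add_volume hr hrp (‖u‖⁻¹ • u.1)
  rw [modular_inv_norm_smul hu, ← ENNReal.le_rpow_inv_iff (by positivity),
    eLpNorm_inv_norm_smul hu] at h
  exact (ENNReal.div_le_iff (enorm_ne_zero.2 hu) enorm_ne_top).1 h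

/-- The exponents `q i` converge to `p` from above along the filter `l`, uniformly on `Ω`. -/
def TendstoFromAbove {ι : Type*} (q : ι → Exponent Ω) (l : Filter ι) (p : Exponent Ω) : Prop :=
  ∀ δ > 0, ∀ᶠ i in l, ∀ x ∈ Ω, q i x ∈ Icc (p x) (p x + δ)

theorem tendstoFromAbove_of_tendstoUniformlyOn {ι : Type*} {l : Filter ι} {q : ι → Exponent Ω}
    (h : TendstoUniformlyOn (fun i x => q i x) p l Ω) (hle : ∀ᶠ i in l, ∀ x ∈ Ω, p x ≤ q i x) :
    TendstoFromAbove q l p := by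
  intro δ hδ
  filter_upwards [Metric.tendstoUniformlyOn_iff.1 h δ hδ, hle] with i hi hpi x hx
  have := (abs_lt.1 (hi x hx)).1
  exact ⟨hpi x hx, by linarith⟩

theorem TendstoFromAbove.eventually_one_sub_mul_norm_le {ι : Type*} {l : Filter ι}
    {q : ι → Exponent Ω} (hq : TendstoFromAbove q l p) (hΩ : volume (Ω : Set (Euc N)) ≠ ⊤) {ε : ℝ}
    (hε : 0 < ε) :
    ∀ᶠ i in l, ∀ (u : VarLp p F) (w : VarLp (q i) F), u.1 = w.1 → (1 - ε) * ‖u‖ ≤ ‖w‖ := by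
  have hV : 0 < 1 + volume.real (Ω : Set (Euc N)) := by positivity
  filter_upwards [hq (ε / (1 + volume.real (Ω : Set (Euc N)))) (by positivity)] with i hi u w huw
  refine VarLp.one_sub_mul_norm_le huw hε.le ((modular_le_modular_add_volume hi _).trans ?_)
  rw [← ofReal_measureReal hΩ, ← ENNReal.ofReal_mul (by positivity)]
  gcongr
  rw [div_mul_eq_mul_div, div_le_iff₀ hV]
  gcongr
  exact le_add_of_nonneg_left zero_le_one

theorem TendstoFromAbove.eventually_one_sub_mul_norm_le_of_eLpNorm_le {ι : Type*} {l : Filter ι}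
    {q : ι → Exponent Ω} (hq : TendstoFromAbove q l p) {S : ℝ} {s : ℝ≥0}
    (hqS : ∀ᶠ i in l, ∀ x ∈ Ω, q i x ≤ S) (hSs : S < s) (C : ℝ≥0) {ε : ℝ} (hε : 0 < ε) :
    ∀ᶠ i in l, ∀ (u : VarLp p F) (w : VarLp (q i) F), u.1 = w.1 →
      eLpNorm w.1 s (volume.restrict (Ω : Set (Euc N))) ≤ C * ‖w‖ₑ → (1 - ε) * ‖w‖ ≤ ‖u‖ := by
  have hsS : 0 < s - S := sub_pos.2 hSs
  have hC : (0 : ℝ) < 1 + C ^ (s : ℝ) := by positivity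
  filter_upwards [hq (ε / (1 + C ^ (s : ℝ)) * (s - S)) (by positivity), hqS] with i hi hiS u w huw
    hwC
  rcases eq_or_ne w 0 with rfl | hw
  · simp
  have hnorm : eLpNorm (‖w‖⁻¹ • w.1 : Euc N →ₘ[volume.restrict (Ω : Set (Euc N))] F) s
      (volume.restrict Ω) ≤ C := by
    rw [VarLp.eLpNorm_inv_norm_smul hw]
    exact (ENNReal.div_le_iff (enorm_ne_zero.2 hw) enorm_ne_top).2 hwC
  refine VarLp.one_sub_mul_norm_le huw.symm hε.le
    ((modular_le_modular_add_eLpNorm hi hiS hSs _).trans ?_)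
  gcongr
  calc _ ≤ ENNReal.ofReal (ε / (1 + C ^ (s : ℝ))) * ENNReal.ofReal (C ^ (s : ℝ)) := by
        rw [mul_div_cancel_right₀ _ hsS.ne', ← NNReal.coe_rpow, ENNReal.ofReal_coe_nnreal,
          ENNReal.coe_rpow_of_nonneg _ s.coe_nonneg, NNReal.coe_rpow]
        gcongr
    _ ≤ ENNReal.ofReal ε := by
        rw [← ENNReal.ofReal_mul (by positivity)]
        gcongr
        rw [div_mul_eq_mul_div, div_le_iff₀ hC]
        gcongr
        exact le_add_of_nonneg_left zero_le_one

end LuxemburgNorm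

section FiniteDimensional

variable {N : ℕ} {Ω : Opens (Euc N)} {p : Exponent Ω}
variable {F : Type*} [NormedAddCommGroup F] [NormedSpace ℝ F]

theorem exists_eLpNorm_le_of_finiteDimensional (W : Submodule ℝ (VarLp p F))
    [FiniteDimensional ℝ W] {s : ℝ≥0∞} [Fact (1 ≤ s)]
    (hW : ∀ u ∈ W, MemLp u.1 s (volume.restrict (Ω : Set (Euc N)))) :
    ∃ C : ℝ≥0, ∀ u ∈ W, eLpNorm u.1 s (volume.restrict (Ω : Set (Euc N))) ≤ C * ‖u‖ₑ := by
  let J : W →ₗ[ℝ] Lp F s (volume.restrict (Ω : Set (Euc N))) :=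
    { toFun := fun u => ⟨u.1.1, Lp.mem_Lp_iff_memLp.2 (hW u u.2)⟩
      map_add' := fun _ _ => rfl
      map_smul' := fun _ _ => rfl }
  refine ⟨‖J.toContinuousLinearMap‖₊, fun u hu => ?_⟩
  have h := J.toContinuousLinearMap.le_opENorm ⟨u, hu⟩
  rwa [Lp.enorm_def] at h

end FiniteDimensional

section TestFunctions

variable {N : ℕ} {Ω : Opens (Euc N)}

variable (Ω) in
/-- The vector space `C_c^∞(Ω)`. -/
def testSpace : Submodule ℝ (Euc N → ℝ) where
  carrier := {φ | IsTestFunction Ω φ}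
  zero_mem' := ⟨contDiff_const, HasCompactSupport.zero, by simp [tsupport]⟩
  add_mem' hφ hψ := ⟨hφ.smooth.add hψ.smooth, hφ.compact.add hψ.compact,
    (tsupport_add _ _).trans (union_subset hφ.supp hψ.supp)⟩
  smul_mem' a φ hφ := ⟨hφ.smooth.const_smul a, hφ.compact.smul_left (f := fun _ => a),
    (tsupport_smul_subset_right (fun _ => a) φ).trans hφ.supp⟩

namespace IsTestFunction

variable {φ ψ : Euc N → ℝ}

theorem differentiable (hφ : IsTestFunction Ω φ) : Differentiable ℝ φ :=
  hφ.smooth.differentiable (by simp)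

theorem continuous_fderiv_apply (hφ : IsTestFunction Ω φ) (v : Euc N) :
    Continuous fun x => fderiv ℝ φ x v :=
  (hφ.smooth.continuous_fderiv (by simp)).clm_apply continuous_const

theorem continuous_gradient (hφ : IsTestFunction Ω φ) : Continuous (gradient φ) :=
  (InnerProductSpace.toDual ℝ (Euc N)).symm.continuous.comp (hφ.smooth.continuous_fderiv (by simp))

theorem hasCompactSupport_gradient (hφ : IsTestFunction Ω φ) : HasCompactSupport (gradient φ) :=
  (hφ.compact.fderiv ℝ).comp_left (map_zero (InnerProductSpace.toDual ℝ (Euc N)).symm)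

theorem eq_zero_of_notMem (hφ : IsTestFunction Ω φ) {x : Euc N} (hx : x ∉ (Ω : Set (Euc N))) :
    φ x = 0 :=
  image_eq_zero_of_notMem_tsupport fun h => hx (hφ.supp h)

theorem isWeakGradient_gradient (hφ : IsTestFunction Ω φ) : IsWeakGradient Ω φ (gradient φ) := by
  intro ψ hψ v
  simp only [inner_gradient_left]
  rw [setIntegral_eq_integral_of_forall_compl_eq_zero fun x hx => by
      rw [hφ.eq_zero_of_notMem hx, zero_mul],
    setIntegral_eq_integral_of_forall_compl_eq_zero fun x hx => by
      rw [hψ.eq_zero_of_notMem hx, mul_zero]]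
  have hφc := hφ.smooth.continuous
  have hψc := hψ.smooth.continuous
  refine integral_mul_fderiv_eq_neg_fderiv_mul_of_integrable ?_ ?_ ?_
    (fun x _ => hφ.differentiable x) (fun x _ => hψ.differentiable x)
  · exact ((hφ.continuous_fderiv_apply v).mul hψc).integrable_of_hasCompactSupport
      hψ.compact.mul_left
  · exact (hφc.mul (hψ.continuous_fderiv_apply v)).integrable_of_hasCompactSupport
      hφ.compact.mul_right
  · exact (hφc.mul hψc).integrable_of_hasCompactSupport hφ.compact.mul_right

end IsTestFunction

theorem IsWeakGradient.congr_ae {u u' : Euc N → ℝ} {G G' : Euc N → Euc N}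
    (hu : u =ᵐ[volume.restrict (Ω : Set (Euc N))] u')
    (hG : G =ᵐ[volume.restrict (Ω : Set (Euc N))] G') (h : IsWeakGradient Ω u G) :
    IsWeakGradient Ω u' G' := by
  intro φ hφ v
  have hu' := integral_congr_ae (hu.mul (ae_eq_refl fun x => fderiv ℝ φ x v))
  have hG' := integral_congr_ae ((hG.fun_comp fun y => ⟪y, v⟫).mul (ae_eq_refl φ))
  exact hu'.symm.trans ((h φ hφ v).trans (congrArg Neg.neg hG'))

theorem IsWeakGradient.ae_eq {u : Euc N → ℝ} {G G' : Euc N → Euc N}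
    (hG : IsWeakGradient Ω u G) (hG' : IsWeakGradient Ω u G') (hi : LocallyIntegrableOn G Ω)
    (hi' : LocallyIntegrableOn G' Ω) : G =ᵐ[volume.restrict (Ω : Set (Euc N))] G' := by
  suffices h : ∀ᵐ x, x ∈ (Ω : Set (Euc N)) → (G - G') x = 0 from
    (ae_restrict_iff' Ω.isOpen.measurableSet).2 (h.mono fun x hx hxΩ => sub_eq_zero.1 (hx hxΩ))
  refine Ω.isOpen.ae_eq_zero_of_integral_contDiff_smul_eq_zero (hi.sub hi') ?_
  intro φ hφ hφc hφs
  have hint {H : Euc N → Euc N} (hH : LocallyIntegrableOn H Ω) :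
      Integrable fun x => φ x • H x := by
    obtain ⟨C, hC⟩ := hφc.exists_bound_of_continuous hφ.continuous
    refine (integrableOn_iff_integrable_of_support_subset
      ((Function.support_smul_subset_left φ H).trans (subset_tsupport φ))).1 ?_
    exact (hH.integrableOn_compact_subset hφs hφc).bdd_smul C hφ.continuous.aestronglyMeasurable
      (ae_of_all _ hC)
  have key {H : Euc N → Euc N} (hH : LocallyIntegrableOn H Ω) (hHu : IsWeakGradient Ω u H)
      (v : Euc N) :
      ⟪∫ x, φ x • H x, v⟫ = -∫ x in (Ω : Set (Euc N)), u x * fderiv ℝ φ x v := by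
    rw [hHu φ ⟨hφ, hφc, hφs⟩ v, neg_neg, real_inner_comm, ← integral_inner (hint hH),
      ← setIntegral_eq_integral_of_forall_compl_eq_zero (s := (Ω : Set (Euc N))) fun x hx => by
        rw [image_eq_zero_of_notMem_tsupport fun h => hx (hφs h), zero_smul, inner_zero_right]]
    exact integral_congr_ae (ae_of_all _ fun x => by
      simp only [real_inner_smul_right, real_inner_comm, mul_comm])
  simp only [Pi.sub_apply, smul_sub]
  rw [integral_sub (hint hi) (hint hi'), sub_eq_zero]
  exact ext_inner_right ℝ fun v => (key hi hG v).trans (key hi' hG' v).symm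

section

variable {F : Type*} [NormedAddCommGroup F] {q : Exponent Ω}

theorem locallyIntegrableOn_of_modular_lt_top
    {u : Euc N →ₘ[volume.restrict (Ω : Set (Euc N))] F} (hu : modular q u < ⊤) :
    LocallyIntegrableOn u Ω := by
  refine (locallyIntegrableOn_iff Ω.isOpen.isLocallyClosed).2 fun K hKΩ hK => ?_
  refine ⟨u.aestronglyMeasurable.mono_measure (Measure.restrict_mono_set _ hKΩ), ?_⟩
  calc ∫⁻ x in K, ‖u x‖ₑ ≤ ∫⁻ x in K, (‖u x‖ₑ ^ q x + 1) := by
        refine setLIntegral_mono_ae' hK.measurableSet (ae_of_all _ fun x hx => ?_)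
        have hx' := hKΩ hx
        have h := rpow_le_rpow_add_const ‖u x‖₊ zero_le_one (q.one_le hx') (q.pos hx')
        rw [ENNReal.rpow_one] at h
        refine h.trans (add_le_add_right (ENNReal.ofReal_le_one.2 ?_) _)
        exact (div_le_one (q.pos hx')).2 (by linarith)
    _ ≤ modular q u + volume K := by
        rw [lintegral_add_right _ measurable_const, setLIntegral_one]
        gcongr
        exact lintegral_mono_set hKΩ
    _ < ⊤ := ENNReal.add_lt_top.2 ⟨hu, hK.measure_lt_top⟩

theorem modular_lt_top_of_integrable_of_memLp_top
    {u : Euc N →ₘ[volume.restrict (Ω : Set (Euc N))] F} (hu : Integrable u (volume.restrict Ω))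
    (hu' : MemLp u ∞ (volume.restrict Ω)) : modular q u < ⊤ := by
  set M := eLpNorm u ∞ (volume.restrict (Ω : Set (Euc N))) with hM
  calc modular q u ≤ ∫⁻ x in (Ω : Set (Euc N)), (1 + M) ^ (N : ℝ) * ‖u x‖ₑ := by
        refine lintegral_mono_ae ?_
        filter_upwards [q.ae_one_le, q.ae_le, enorm_ae_le_eLpNormEssSup u _] with x h1 hN hx
        rw [← eLpNorm_exponent_top, ← hM] at hx
        calc ‖u x‖ₑ ^ q x = ‖u x‖ₑ ^ (q x - 1) * ‖u x‖ₑ ^ (1 : ℝ) := by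
              rw [← ENNReal.rpow_add_of_nonneg _ _ (by linarith) zero_le_one, sub_add_cancel]
          _ ≤ (1 + M) ^ (q x - 1) * ‖u x‖ₑ := by
              rw [ENNReal.rpow_one]
              gcongr
              exact hx.trans le_add_self
          _ ≤ (1 + M) ^ (N : ℝ) * ‖u x‖ₑ := by
              gcongr
              · exact le_self_add
              · linarith
    _ = (1 + M) ^ (N : ℝ) * ∫⁻ x in (Ω : Set (Euc N)), ‖u x‖ₑ :=
        lintegral_const_mul'' _ hu.1.enorm
    _ < ⊤ := ENNReal.mul_lt_top (ENNReal.rpow_lt_top_of_nonneg N.cast_nonneg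
        (ENNReal.add_ne_top.2 ⟨ENNReal.one_ne_top, hu'.eLpNorm_ne_top⟩)) hu.2

theorem modular_mk_lt_top {f : Euc N → F} (hf : Continuous f) (hc : HasCompactSupport f) :
    modular q (AEEqFun.mk f hf.aestronglyMeasurable) < ⊤ := by
  have hae := AEEqFun.coeFn_mk (μ := volume.restrict (Ω : Set (Euc N))) f hf.aestronglyMeasurable
  exact modular_lt_top_of_integrable_of_memLp_top
    ((integrable_congr hae).2 (hf.integrable_of_hasCompactSupport hc))
    ((memLp_congr_ae hae).2 (hf.memLp_of_hasCompactSupport hc))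

end

theorem gradient_add {φ ψ : Euc N → ℝ} (hφ : Differentiable ℝ φ) (hψ : Differentiable ℝ ψ) :
    gradient (φ + ψ) = gradient φ + gradient ψ := by
  funext x
  simp only [gradient, Pi.add_apply, fderiv_add (hφ x) (hψ x), map_add]

theorem gradient_const_smul (a : ℝ) {φ : Euc N → ℝ} (hφ : Differentiable ℝ φ) :
    gradient (a • φ) = a • gradient φ := by
  funext x
  simp only [gradient, Pi.smul_apply, fderiv_const_smul (hφ x), map_smulₛₗ, conj_trivial]

/-- The element `(φ, ∇φ)` of the Sobolev space defined by a test function `φ`. -/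
def testPair (q : Exponent Ω) : testSpace Ω →ₗ[ℝ] LpPair q where
  toFun φ := WithLp.toLp 1
    (⟨AEEqFun.mk φ.1 φ.2.smooth.continuous.aestronglyMeasurable,
      modular_mk_lt_top φ.2.smooth.continuous φ.2.compact⟩,
    ⟨AEEqFun.mk (gradient φ.1) φ.2.continuous_gradient.aestronglyMeasurable,
      modular_mk_lt_top φ.2.continuous_gradient φ.2.hasCompactSupport_gradient⟩)
  map_add' φ ψ := by
    refine congrArg (WithLp.toLp 1) (Prod.ext rfl (Subtype.ext ?_))
    simp only [Submodule.coe_add, gradient_add φ.2.differentiable ψ.2.differentiable]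
    rfl
  map_smul' a φ := by
    refine congrArg (WithLp.toLp 1) (Prod.ext rfl (Subtype.ext ?_))
    simp only [SetLike.val_smul, gradient_const_smul a φ.2.differentiable]
    rfl

theorem coeFn_testPair_fn (q : Exponent Ω) (φ : testSpace Ω) :
    (testPair q φ).fn =ᵐ[volume.restrict (Ω : Set (Euc N))] φ.1 :=
  AEEqFun.coeFn_mk _ _

theorem coeFn_testPair_grad (q : Exponent Ω) (φ : testSpace Ω) :
    (testPair q φ).grad =ᵐ[volume.restrict (Ω : Set (Euc N))] gradient φ.1 :=
  AEEqFun.coeFn_mk _ _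

theorem testPair_mem_sobolev (q : Exponent Ω) (φ : testSpace Ω) : testPair q φ ∈ sobolev q :=
  φ.2.isWeakGradient_gradient.congr_ae (coeFn_testPair_fn q φ).symm (coeFn_testPair_grad q φ).symm

theorem testPair_mem_sobolevZero (q : Exponent Ω) (φ : testSpace Ω) :
    testPair q φ ∈ sobolevZero q :=
  ⟨testPair_mem_sobolev q φ,
    subset_closure ⟨testPair_mem_sobolev q φ, φ.1, φ.2, coeFn_testPair_fn q φ⟩⟩

theorem eq_testPair_of_ae_eq {q : Exponent Ω} {w : LpPair q} (hw : w ∈ sobolev q)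
    (φ : testSpace Ω) (h : w.fn =ᵐ[volume.restrict (Ω : Set (Euc N))] φ.1) :
    w = testPair q φ := by
  have hfn : w.fn = (testPair q φ).fn := AEEqFun.ext (h.trans (coeFn_testPair_fn q φ).symm)
  have hgrad : w.grad = (testPair q φ).grad := by
    refine AEEqFun.ext (IsWeakGradient.ae_eq hw ?_ (locallyIntegrableOn_of_modular_lt_top w.snd.2)
      (locallyIntegrableOn_of_modular_lt_top (testPair q φ).snd.2))
    rw [hfn]
    exact testPair_mem_sobolev q φ
  exact WithLp.ofLp_injective 1 (Prod.ext (Subtype.ext hfn) (Subtype.ext hgrad))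

theorem sobolevZero_subset_closure_range_testPair (q : Exponent Ω) :
    sobolevZero q ⊆ closure (range (testPair q)) := by
  refine inter_subset_right.trans (closure_mono ?_)
  rintro w ⟨hw, φ, hφ, h⟩
  exact ⟨⟨φ, hφ⟩, (eq_testPair_of_ae_eq hw ⟨φ, hφ⟩ h).symm⟩

end TestFunctions

section Sobolev

variable {N : ℕ} {Ω : Opens (Euc N)}

theorem IsTestFunction.eLpNorm_le_eLpNorm_gradient {φ : Euc N → ℝ} (hφ : IsTestFunction Ω φ)
    {r s : ℝ≥0} (hr : 1 ≤ r) (hN : 0 < N) (hs : (s : ℝ)⁻¹ = (r : ℝ)⁻¹ - (N : ℝ)⁻¹) :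
    eLpNorm φ s (volume.restrict (Ω : Set (Euc N))) ≤
      eLpNormLESNormFDerivOfEqInnerConst (volume : Measure (Euc N)) r *
        eLpNorm (gradient φ) r (volume.restrict (Ω : Set (Euc N))) := by
  have hgrad : eLpNorm (gradient φ) r (volume.restrict (Ω : Set (Euc N))) =
      eLpNorm (fderiv ℝ φ) r volume := by
    rw [eLpNorm_restrict_eq_of_support_subset]
    · exact eLpNorm_congr_norm_ae (ae_of_all _ fun x => LinearIsometryEquiv.norm_map _ _)
    · intro x hx
      refine hφ.supp (support_fderiv_subset ℝ fun h => hx ?_)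
      rw [gradient, h, map_zero]
  rw [hgrad]
  exact (eLpNorm_restrict_le _ _ _ _).trans
    (eLpNorm_le_eLpNorm_fderiv_of_eq_inner volume (hφ.smooth.of_le (by simp)) hφ.compact hr
      (by rwa [finrank_euclideanSpace_fin]) (by rwa [finrank_euclideanSpace_fin]))

theorem exists_eLpNorm_testPair_fst_le (hΩ : volume (Ω : Set (Euc N)) ≠ ⊤) {r s : ℝ≥0}
    (hr : 1 ≤ r) (hN : 0 < N) (hs : (s : ℝ)⁻¹ = (r : ℝ)⁻¹ - (N : ℝ)⁻¹) :
    ∃ C : ℝ≥0, ∀ q : Exponent Ω, (∀ x ∈ Ω, r ≤ q x) → ∀ φ : testSpace Ω,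
      eLpNorm (testPair q φ).fst.1 s (volume.restrict (Ω : Set (Euc N))) ≤
        C * ‖(testPair q φ).snd‖ₑ := by
  have hB : (1 + volume (Ω : Set (Euc N))) ^ (r : ℝ)⁻¹ ≠ ⊤ :=
    ENNReal.rpow_ne_top_of_nonneg (by positivity) (ENNReal.add_ne_top.2 ⟨ENNReal.one_ne_top, hΩ⟩)
  refine ⟨eLpNormLESNormFDerivOfEqInnerConst (volume : Measure (Euc N)) r *
    ((1 + volume (Ω : Set (Euc N))) ^ (r : ℝ)⁻¹).toNNReal, fun q hrq φ => ?_⟩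
  rw [ENNReal.coe_mul, ENNReal.coe_toNNReal hB, mul_assoc]
  calc _ = eLpNorm φ.1 s (volume.restrict (Ω : Set (Euc N))) :=
        eLpNorm_congr_ae (coeFn_testPair_fn q φ)
    _ ≤ _ := φ.2.eLpNorm_le_eLpNorm_gradient hr hN hs
    _ ≤ _ := by
        gcongr
        rw [← eLpNorm_congr_ae (coeFn_testPair_grad q φ)]
        exact VarLp.eLpNorm_le (one_pos.trans_le hr).ne' hrq _

end Sobolev

section Genus

theorem genus_le_of_odd_map {V W : Type*} [TopologicalSpace V] [Neg V] [TopologicalSpace W] [Neg W]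
    {K : Set V} {A : Set W} {c : V → W} (hc : ContinuousOn c K) (hKA : MapsTo c K A)
    (hodd : ∀ u ∈ K, c (-u) = -c u) : genus K ≤ genus A := by
  refine le_iInf₂ fun k ⟨f, hf, hfA⟩ => iInf₂_le k ⟨f ∘ c, hf.comp hc hKA, fun u hu => ?_⟩
  obtain ⟨hneg, hne⟩ := hfA (c u) (hKA hu)
  exact ⟨by rw [Function.comp_apply, hodd u hu, hneg, Function.comp_apply], hne⟩

variable {E : Type*} [NormedAddCommGroup E] [NormedSpace ℝ E] {K : Set E} {ε : ℝ}

theorem exists_continuous_norm_sub_linearCombination_lt {ι : Type*} [Fintype ι] (hK : IsClosed K)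
    (x : ι → E) (h : K ⊆ ⋃ i, Metric.ball (x i) ε) :
    ∃ b : E → ι → ℝ, Continuous b ∧
      ∀ u ∈ K, ‖u - Fintype.linearCombination ℝ x (b u)‖ < ε := by
  obtain ⟨f, hf⟩ := PartitionOfUnity.exists_isSubordinate hK _ (fun _ => Metric.isOpen_ball) h
  refine ⟨fun u i => f i u, continuous_pi fun i => (f i).continuous, fun u hu => ?_⟩
  have hmem := f.finsum_smul_mem_convex (g := fun i _ => x i) hu
    (fun i hi => Metric.mem_ball_comm.1 (hf i (subset_tsupport _ hi))) (convex_ball u ε)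
  rwa [finsum_eq_sum_of_fintype, Metric.mem_ball_comm, mem_ball_iff_norm] at hmem

theorem exists_odd_norm_sub_lt {V : Type*} [AddCommGroup V] [Module ℝ V] (T : V →ₗ[ℝ] E)
    (hK : IsCompact K) (hneg : ∀ u ∈ K, -u ∈ K) (hT : K ⊆ closure (range T)) (hε : 0 < ε) :
    ∃ (n : ℕ) (L : (Fin n → ℝ) →ₗ[ℝ] V) (c : E → Fin n → ℝ), Continuous c ∧
      (∀ u, c (-u) = -c u) ∧ ∀ u ∈ K, ‖u - T (L (c u))‖ < ε := by
  obtain ⟨t, ht⟩ := hK.elim_finite_subcover (fun φ : V => Metric.ball (T φ) ε)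
    (fun _ => Metric.isOpen_ball) fun u hu => by
      obtain ⟨_, ⟨φ, rfl⟩, h⟩ := Metric.mem_closure_iff.1 (hT hu) ε hε
      exact mem_iUnion.2 ⟨φ, h⟩
  let x : Fin t.card → V := fun i => t.equivFin.symm i
  obtain ⟨b, hb, hbK⟩ := exists_continuous_norm_sub_linearCombination_lt hK.isClosed (T ∘ x)
    fun u hu => by
      obtain ⟨φ, hφ, h⟩ := mem_iUnion₂.1 (ht hu)
      exact mem_iUnion.2 ⟨t.equivFin ⟨φ, hφ⟩, by simpa [x] using h⟩
  set L := Fintype.linearCombination ℝ x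
  have hTL (d : Fin t.card → ℝ) : Fintype.linearCombination ℝ (T ∘ x) d = T (L d) := by
    simp only [L, Fintype.linearCombination_apply, map_sum, map_smul, Function.comp_apply]
  simp only [hTL] at hbK
  refine ⟨t.card, L, fun u => (1 / 2 : ℝ) • (b u - b (-u)), by fun_prop, fun u => ?_,
    fun u hu => ?_⟩
  · simp only [neg_neg, ← smul_neg, neg_sub]
  · have hodd : u - T (L ((1 / 2 : ℝ) • (b u - b (-u)))) =
        (1 / 2 : ℝ) • ((u - T (L (b u))) - (-u - T (L (b (-u))))) := by
      simp only [map_smul, map_sub]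
      module
    rw [hodd, norm_smul, Real.norm_of_nonneg (by norm_num)]
    linarith [norm_sub_le (u - T (L (b u))) (-u - T (L (b (-u)))), hbK u hu, hbK (-u) (hneg u hu)]

end Genus

section RayleighBound

variable {N : ℕ} {Ω : Opens (Euc N)} {q : Exponent Ω} {m : ℕ} {a : ℝ}

theorem LpPair.norm_fst_le (w : LpPair q) : ‖w.fst‖ ≤ ‖w‖ := by
  rw [WithLp.prod_norm_eq_of_L1]
  exact le_add_of_nonneg_right (norm_nonneg _)

theorem LpPair.norm_snd_le (w : LpPair q) : ‖w.snd‖ ≤ ‖w‖ := by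
  rw [WithLp.prod_norm_eq_of_L1]
  exact le_add_of_nonneg_left (norm_nonneg _)

/-- Some symmetric compact set of genus `≥ m` in a finite-dimensional space of test functions has
all its Rayleigh quotients `‖∇φ‖_{q(x)} / ‖φ‖_{q(x)}` below `a`. The set is given in coordinates,
so that it does not depend on the exponent. -/
def IsRayleighBound (q : Exponent Ω) (m : ℕ) (a : ℝ) : Prop :=
  ∃ (n : ℕ) (T : (Fin n → ℝ) →ₗ[ℝ] testSpace Ω) (A : Set (Fin n → ℝ)), IsCompact A ∧
    (∀ c ∈ A, -c ∈ A) ∧ m ≤ genus A ∧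
      ∀ c ∈ A, ‖(testPair q (T c)).snd‖ < a * ‖(testPair q (T c)).fst‖

theorem exists_norm_snd_lt_of_norm_sub_lt {b : ℝ} (hb : 0 ≤ b) (hba : b < a) :
    ∃ ε > 0, ∀ u w : LpPair q, ‖u.fst‖ = 1 → ‖u.snd‖ ≤ b → ‖u - w‖ < ε →
      ‖w.snd‖ < a * ‖w.fst‖ := by
  refine ⟨(a - b) / (1 + a), div_pos (by linarith) (by linarith), fun u w hu hub hε => ?_⟩
  rw [lt_div_iff₀ (by linarith)] at hε
  have hfst : 1 - ‖u - w‖ ≤ ‖w.fst‖ := by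
    linarith [norm_sub_norm_le u.fst w.fst, WithLp.sub_fst u w ▸ LpPair.norm_fst_le (u - w)]
  have hsnd : ‖w.snd‖ ≤ b + ‖u - w‖ := by
    linarith [norm_sub_norm_le w.snd u.snd, norm_sub_rev w.snd u.snd,
      WithLp.sub_snd u w ▸ LpPair.norm_snd_le (u - w)]
  calc ‖w.snd‖ ≤ b + ‖u - w‖ := hsnd
    _ < a * (1 - ‖u - w‖) := by linarith
    _ ≤ a * ‖w.fst‖ := mul_le_mul_of_nonneg_left hfst (by linarith)

theorem isRayleighBound_of_eigenvalue_lt (h : eigenvalue q m < ENNReal.ofReal a) :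
    IsRayleighBound q m a := by
  obtain ⟨K, ⟨hKc, hKneg, hKsub, hKg⟩, hKa⟩ := by simpa only [eigenvalue, iInf_lt_iff] using h
  obtain ⟨b, hb, hKb, hba⟩ := ENNReal.lt_iff_exists_real_btwn.1 hKa
  have hub (u : LpPair q) (hu : u ∈ K) : ‖u.snd‖ ≤ b :=
    (ENNReal.ofReal_le_ofReal_iff hb).1 ((le_iSup₂ (f := fun (u : LpPair q) (_ : u ∈ K) =>
      ENNReal.ofReal ‖u.snd‖) u hu).trans hKb.le)
  obtain ⟨ε, hε, hεK⟩ := exists_norm_snd_lt_of_norm_sub_lt (q := q) hb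
    ((ENNReal.ofReal_lt_ofReal_iff_of_nonneg hb).1 hba)
  obtain ⟨n, T, c, hc, hodd, hcK⟩ := exists_odd_norm_sub_lt (testPair q) hKc hKneg
    (fun u hu => sobolevZero_subset_closure_range_testPair q (hKsub hu).1) hε
  refine ⟨n, T, c '' K, hKc.image hc, ?_,
    hKg.trans (genus_le_of_odd_map hc.continuousOn (mapsTo_image c K) fun u _ => hodd u), ?_⟩
  · rintro _ ⟨u, hu, rfl⟩
    exact ⟨-u, hKneg u hu, hodd u⟩
  · rintro _ ⟨u, hu, rfl⟩
    exact hεK u _ (hKsub hu).2 (hub u hu) (hcK u hu)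

theorem IsRayleighBound.eigenvalue_le (h : IsRayleighBound q m a) :
    eigenvalue q m ≤ ENNReal.ofReal a := by
  obtain ⟨n, T, A, hA, hneg, hg, hlt⟩ := h
  have hcont : Continuous fun c => testPair q (T c) :=
    ((testPair q).comp T).continuous_of_finiteDimensional
  have hpos (c) (hc : c ∈ A) : 0 < ‖(testPair q (T c)).fst‖ :=
    (norm_nonneg _).lt_of_ne fun h0 => (norm_nonneg _).not_gt (by simpa [← h0] using hlt c hc)
  let f : (Fin n → ℝ) → LpPair q := fun c => ‖(testPair q (T c)).fst‖⁻¹ • testPair q (T c)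
  have hf : ContinuousOn f A :=
    ((WithLp.continuous_fst 1 _ _).comp hcont).norm.continuousOn.inv₀ (fun c hc => (hpos c hc).ne')
      |>.smul hcont.continuousOn
  have hodd (c) : f (-c) = -f c := by
    simp only [f, map_neg, WithLp.neg_fst, norm_neg, smul_neg]
  have hmem : f '' A ∈ minimaxSets q m := by
    refine ⟨hA.image_of_continuousOn hf, ?_, ?_,
      hg.trans (genus_le_of_odd_map hf (mapsTo_image f A) fun c _ => hodd c)⟩
    · rintro _ ⟨c, hc, rfl⟩
      exact ⟨-c, hneg c hc, hodd c⟩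
    · rintro _ ⟨c, hc, rfl⟩
      refine ⟨?_, ?_⟩
      · simp only [f, ← map_smul]
        exact testPair_mem_sobolevZero q _
      · simp only [f, WithLp.smul_fst, norm_smul, norm_inv, norm_norm]
        exact inv_mul_cancel₀ (hpos c hc).ne'
  refine (iInf₂_le (f '' A) hmem).trans (iSup₂_le ?_)
  rintro _ ⟨c, hc, rfl⟩
  refine ENNReal.ofReal_le_ofReal ?_
  simp only [f, WithLp.smul_snd, norm_smul, norm_inv, norm_norm]
  rw [inv_mul_le_iff₀ (hpos c hc), mul_comm]
  exact (hlt c hc).le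

end RayleighBound

section Convergence

variable {N : ℕ} {Ω : Opens (Euc N)} {p : Exponent Ω}

theorem exists_pos_forall_lt_mul_of_one_sub_mul_le {a b : ℝ} (hab : a < b) :
    ∃ ε > 0, ∀ x x' y y' : ℝ, 0 ≤ x → 0 ≤ y → (1 - ε) * x' ≤ x → (1 - ε) * y ≤ y' →
      x < a * y → x' < b * y' := by
  have hlim : Tendsto (fun ε : ℝ => (1 - ε) ^ 2 * b) (𝓝[>] 0) (𝓝 b) := by
    have h : Continuous fun ε : ℝ => (1 - ε) ^ 2 * b := by fun_prop
    simpa using (h.tendsto 0).mono_left nhdsWithin_le_nhds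
  obtain ⟨ε, hεb, hε0, hε1⟩ :=
    ((hlim.eventually_const_lt hab).and (Ioo_mem_nhdsGT one_pos)).exists
  refine ⟨ε, hε0, fun x x' y y' hx hy hx' hy' hxy => ?_⟩
  have hε : 0 < 1 - ε := sub_pos.2 hε1
  have ha : 0 < a := pos_of_mul_pos_left (hx.trans_lt hxy) hy
  have hy'0 : 0 ≤ y' := (mul_nonneg hε.le hy).trans hy'
  refine lt_of_mul_lt_mul_left ?_ (sq_nonneg (1 - ε))
  calc (1 - ε) ^ 2 * x' = (1 - ε) * ((1 - ε) * x') := by ring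
    _ ≤ (1 - ε) * x := by gcongr
    _ < (1 - ε) * (a * y) := by gcongr
    _ = a * ((1 - ε) * y) := by ring
    _ ≤ a * y' := by gcongr
    _ ≤ (1 - ε) ^ 2 * b * y' := by gcongr
    _ = (1 - ε) ^ 2 * (b * y') := mul_assoc _ _ _

variable {ι : Type*} {l : Filter ι} {q : ι → Exponent Ω} {m : ℕ} {a b : ℝ}

theorem TendstoFromAbove.eventually_one_sub_mul_norm_le_of_finiteDimensional
    {F : Type*} [NormedAddCommGroup F] [NormedSpace ℝ F] (hq : TendstoFromAbove q l p)
    (hΩ : volume (Ω : Set (Euc N)) ≠ ⊤) (W : Submodule ℝ (VarLp p F)) [FiniteDimensional ℝ W]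
    (hW : ∀ u ∈ W, MemLp u.1 (N + 1) (volume.restrict (Ω : Set (Euc N)))) {ε : ℝ} (hε : 0 < ε) :
    ∀ᶠ i in l, ∀ u ∈ W, ∀ w : VarLp (q i) F, u.1 = w.1 → (1 - ε) * ‖w‖ ≤ ‖u‖ := by
  have : Fact ((1 : ℝ≥0∞) ≤ N + 1) := ⟨le_add_self⟩
  obtain ⟨C, hC⟩ := exists_eLpNorm_le_of_finiteDimensional W hW
  have hqN : ∀ᶠ i in l, ∀ x ∈ Ω, q i x ≤ N := Eventually.of_forall fun i x hx => by
    obtain ⟨b, hbN, hb⟩ := (q i).sup_lt_dim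
    exact (hb x hx).trans hbN.le
  filter_upwards [hq.eventually_one_sub_mul_norm_le hΩ (F := F) one_half_pos,
    hq.eventually_one_sub_mul_norm_le_of_eLpNorm_le (F := F) (s := N + 1) hqN (by simp) (C * 2) hε]
    with i hi hi' u hu w huw
  refine hi' u w huw ?_
  have hle : ‖u‖ₑ ≤ 2 * ‖w‖ₑ :=
    calc ‖u‖ₑ = ENNReal.ofReal ‖u‖ := (ofReal_norm u).symm
      _ ≤ ENNReal.ofReal (2 * ‖w‖) := ENNReal.ofReal_le_ofReal (by linarith [hi u w huw])
      _ = 2 * ‖w‖ₑ := by rw [ENNReal.ofReal_mul zero_le_two, ENNReal.ofReal_ofNat, ofReal_norm]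
  rw [← huw, ENNReal.coe_mul, mul_assoc]
  push_cast
  exact (hC u hu).trans (by gcongr)

theorem IsRayleighBound.eventually_of_tendstoFromAbove (h : IsRayleighBound p m a) (hab : a < b)
    (hq : TendstoFromAbove q l p) (hΩ : volume (Ω : Set (Euc N)) ≠ ⊤) :
    ∀ᶠ i in l, IsRayleighBound (q i) m b := by
  obtain ⟨n, T, A, hA, hneg, hg, hlt⟩ := h
  obtain ⟨ε, hε, hεab⟩ := exists_pos_forall_lt_mul_of_one_sub_mul_le hab
  let D : (Fin n → ℝ) →ₗ[ℝ] VarLp p (Euc N) :=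
    WithLp.sndₗ 1 ℝ (VarLp p ℝ) (VarLp p (Euc N)) ∘ₗ testPair p ∘ₗ T
  have hD : ∀ u ∈ D.range, MemLp u.1 (N + 1) (volume.restrict (Ω : Set (Euc N))) := by
    rintro _ ⟨c, rfl⟩
    exact (memLp_congr_ae (coeFn_testPair_grad p (T c))).2
      ((T c).2.continuous_gradient.memLp_of_hasCompactSupport (T c).2.hasCompactSupport_gradient)
  filter_upwards [hq.eventually_one_sub_mul_norm_le hΩ (F := ℝ) hε,
    hq.eventually_one_sub_mul_norm_le_of_finiteDimensional hΩ D.range hD hε] with i hfn hgrad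
  exact ⟨n, T, A, hA, hneg, hg, fun c hc => hεab _ _ _ _ (norm_nonneg _) (norm_nonneg _)
    (hgrad _ ⟨c, rfl⟩ _ rfl) (hfn _ _ rfl) (hlt c hc)⟩

theorem TendstoFromAbove.eventually_isRayleighBound (hq : TendstoFromAbove q l p)
    (hΩ : volume (Ω : Set (Euc N)) ≠ ⊤) {r s : ℝ≥0} {S : ℝ} (hr : 1 ≤ r) (hN : 0 < N)
    (hs : (s : ℝ)⁻¹ = (r : ℝ)⁻¹ - (N : ℝ)⁻¹) (hSs : S < s)
    (hrS : ∀ᶠ i in l, ∀ x ∈ Ω, q i x ∈ Icc (r : ℝ) S) (hab : a < b) :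
    ∀ᶠ i in l, IsRayleighBound (q i) m a → IsRayleighBound p m b := by
  obtain ⟨C, hC⟩ := exists_eLpNorm_testPair_fst_le hΩ hr hN hs
  obtain ⟨ε, hε, hεab⟩ := exists_pos_forall_lt_mul_of_one_sub_mul_le hab
  filter_upwards [hrS, hq.eventually_one_sub_mul_norm_le hΩ (F := Euc N) hε,
    hq.eventually_one_sub_mul_norm_le_of_eLpNorm_le (F := ℝ)
      (hrS.mono fun i hi x hx => (hi x hx).2) hSs (C * a.toNNReal) hε] with i hi hgrad hfn
  rintro ⟨n, T, A, hA, hneg, hg, hlt⟩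
  refine ⟨n, T, A, hA, hneg, hg, fun c hc => hεab _ _ _ _ (norm_nonneg _) (norm_nonneg _)
    (hgrad _ _ rfl) (hfn (testPair p (T c)).fst (testPair (q i) (T c)).fst rfl ?_) (hlt c hc)⟩
  have hle : ‖(testPair (q i) (T c)).snd‖ₑ ≤ a.toNNReal * ‖(testPair (q i) (T c)).fst‖ₑ := by
    rw [← ofReal_norm, ← ofReal_norm]
    exact (ENNReal.ofReal_le_ofReal (hlt c hc).le).trans_eq (ENNReal.ofReal_mul' (norm_nonneg _))
  rw [ENNReal.coe_mul, mul_assoc]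
  exact (hC (q i) (fun x hx => (hi x hx).1) (T c)).trans (by gcongr)

theorem TendstoFromAbove.eventually_eigenvalue_lt (hq : TendstoFromAbove q l p)
    (hΩ : volume (Ω : Set (Euc N)) ≠ ⊤) {μ : ℝ≥0∞} (hμ : eigenvalue p m < μ) :
    ∀ᶠ i in l, eigenvalue (q i) m < μ := by
  obtain ⟨b, -, hpb, hbμ⟩ := ENNReal.lt_iff_exists_real_btwn.1 hμ
  obtain ⟨a, ha, hpa, hab⟩ := ENNReal.lt_iff_exists_real_btwn.1 hpb
  filter_upwards [(isRayleighBound_of_eigenvalue_lt hpa).eventually_of_tendstoFromAbove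
    ((ENNReal.ofReal_lt_ofReal_iff_of_nonneg ha).1 hab) hq hΩ] with i hi
  exact hi.eigenvalue_le.trans_lt hbμ

theorem TendstoFromAbove.eventually_lt_eigenvalue (hq : TendstoFromAbove q l p)
    (hΩ : volume (Ω : Set (Euc N)) ≠ ⊤) {r s : ℝ≥0} {S : ℝ} (hr : 1 ≤ r) (hN : 0 < N)
    (hs : (s : ℝ)⁻¹ = (r : ℝ)⁻¹ - (N : ℝ)⁻¹) (hSs : S < s)
    (hrS : ∀ᶠ i in l, ∀ x ∈ Ω, q i x ∈ Icc (r : ℝ) S) {μ : ℝ≥0∞} (hμ : μ < eigenvalue p m) :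
    ∀ᶠ i in l, μ < eigenvalue (q i) m := by
  obtain ⟨b, -, hμb, hbp⟩ := ENNReal.lt_iff_exists_real_btwn.1 hμ
  obtain ⟨a, ha, hμa, hab⟩ := ENNReal.lt_iff_exists_real_btwn.1 hμb
  filter_upwards [hq.eventually_isRayleighBound (m := m) hΩ hr hN hs hSs hrS
    ((ENNReal.ofReal_lt_ofReal_iff_of_nonneg ha).1 hab)] with i hi
  by_contra! hle
  exact hbp.not_ge (hi (isRayleighBound_of_eigenvalue_lt (hle.trans_lt hμa))).eigenvalue_le

theorem theorem1p1_general (hΩ : volume (Ω : Set (Euc N)) ≠ ⊤) {r S : ℝ} (hr : 1 ≤ r)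
    (hrN : r < N) (hS : S < N * r / (N - r)) (hrS : ∀ᶠ i in l, ∀ x ∈ Ω, q i x ∈ Icc r S)
    (hunif : TendstoUniformlyOn (fun i x => q i x) p l Ω)
    (hle : ∀ᶠ i in l, ∀ x ∈ Ω, p x ≤ q i x) :
    Tendsto (fun i => eigenvalue (q i) m) l (𝓝 (eigenvalue p m)) := by
  have hq := tendstoFromAbove_of_tendstoUniformlyOn hunif hle
  have hr0 : 0 < r := one_pos.trans_le hr
  have hN : 0 < (N : ℝ) := hr0.trans hrN
  have hNr : 0 < N - r := sub_pos.2 hrN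
  lift r to ℝ≥0 using hr0.le
  obtain ⟨s, hs⟩ : ∃ s : ℝ≥0, (s : ℝ) = N * r / (N - r) := ⟨⟨_, by positivity⟩, rfl⟩
  have hconj : (s : ℝ)⁻¹ = (r : ℝ)⁻¹ - (N : ℝ)⁻¹ := by
    rw [hs]
    field_simp
  exact tendsto_order.2 ⟨fun μ => hq.eventually_lt_eigenvalue hΩ (NNReal.one_le_coe.1 hr)
    (Nat.cast_pos.1 hN) hconj (hs ▸ hS) hrS, fun μ => hq.eventually_eigenvalue_lt hΩ⟩

theorem IsSubcriticalSeq.exists_bounds {q : ℕ → Exponent Ω} (hq : IsSubcriticalSeq q) :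
    ∃ r S : ℝ, 1 ≤ r ∧ r < N ∧ S < N * r / (N - r) ∧
      ∀ᶠ h in atTop, ∀ x ∈ Ω, q h x ∈ Icc r S := by
  obtain ⟨k, -, hk⟩ := hq
  dsimp only at hk
  set R : Set ℝ := {t | ∃ h, k ≤ h ∧ ∃ x ∈ Ω, t = q h x}
  have hR1 : ∀ t ∈ R, 1 ≤ t := by
    rintro _ ⟨h, -, x, hx, rfl⟩
    exact (q h).one_le hx
  have hRN : ∀ t ∈ R, t < N := by
    rintro _ ⟨h, -, x, hx, rfl⟩
    obtain ⟨b, hb, hbx⟩ := (q h).sup_lt_dim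
    exact (hbx x hx).trans_lt hb
  have hR : R.Nonempty := by
    rw [nonempty_iff_ne_empty]
    intro h
    simp [h] at hk
  refine ⟨sInf R, sSup R, le_csInf hR hR1, ?_, hk, ?_⟩
  · obtain ⟨t, ht⟩ := hR
    exact (csInf_le ⟨1, hR1⟩ ht).trans_lt (hRN t ht)
  · filter_upwards [eventually_ge_atTop k] with h hh x hx
    exact ⟨csInf_le ⟨1, hR1⟩ ⟨h, hh, x, hx, rfl⟩,
      le_csSup ⟨N, fun t ht => (hRN t ht).le⟩ ⟨h, hh, x, hx, rfl⟩⟩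

end Convergence

end VarExp

open VarExp in
theorem theorem1p1_general {N : ℕ} {Ω : Opens (EuclideanSpace ℝ (Fin N))} {m : ℕ} {ι : Type*}
    {l : Filter ι} {p : Exponent Ω} {q : ι → Exponent Ω}
    (hΩ : volume (Ω : Set (EuclideanSpace ℝ (Fin N))) ≠ ⊤)
    {r S : ℝ} (hr : 1 ≤ r) (hrN : r < N) (hS : S < N * r / (N - r))
    (hrS : ∀ᶠ i in l, ∀ x ∈ Ω, q i x ∈ Icc r S)
    (hunif : TendstoUniformlyOn (fun i x => q i x) p l Ω)
    (hle : ∀ᶠ i in l, ∀ x ∈ Ω, p x ≤ q i x) :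
    Tendsto (fun i => eigenvalue (q i) m) l (𝓝 (eigenvalue p m)) := by
  have hq := tendstoFromAbove_of_tendstoUniformlyOn hunif hle
  have hr0 : 0 < r := one_pos.trans_le hr
  have hN : 0 < (N : ℝ) := hr0.trans hrN
  have hNr : 0 < N - r := sub_pos.2 hrN
  lift r to ℝ≥0 using hr0.le
  obtain ⟨s, hs⟩ : ∃ s : ℝ≥0, (s : ℝ) = N * r / (N - r) := ⟨⟨_, by positivity⟩, rfl⟩
  have hconj : (s : ℝ)⁻¹ = (r : ℝ)⁻¹ - (N : ℝ)⁻¹ := by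
    rw [hs]
    field_simp
  exact tendsto_order.2 ⟨fun μ => hq.eventually_lt_eigenvalue hΩ (NNReal.one_le_coe.1 hr)
    (Nat.cast_pos.1 hN) hconj (hs ▸ hS) hrS, fun μ => hq.eventually_eigenvalue_lt hΩ⟩

end

theorem theorem1p1 {N : ℕ} (hN : 2 ≤ N) (Ω : TopologicalSpace.Opens (EuclideanSpace ℝ (Fin N)))
    (hbdd : Bornology.IsBounded (Ω : Set (EuclideanSpace ℝ (Fin N))))
    (hconn : IsConnected (Ω : Set (EuclideanSpace ℝ (Fin N))))
    (hlip : VarExp.HasLipschitzBoundary Ω)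
    (m : ℕ) (hm : 1 ≤ m)
    (p : VarExp.Exponent Ω) (ph : ℕ → VarExp.Exponent Ω)
    (hS : VarExp.IsSubcriticalSeq ph)
    (hunif : TendstoUniformlyOn (fun h x => ph h x) p Filter.atTop
      (Ω : Set (EuclideanSpace ℝ (Fin N))))
    (hle : ∀ h, ∀ x ∈ Ω, p x ≤ ph h x) :
    Filter.Tendsto (fun h => VarExp.eigenvalue (ph h) m) Filter.atTop
      (nhds (VarExp.eigenvalue p m)) := by
  obtain ⟨r, S, hr, hrN, hrS, hbounds⟩ := hS.exists_bounds
  exact theorem1p1_general hbdd.measure_lt_top.ne hr hrN hrS hbounds hunif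
    (Filter.Eventually.of_forall hle)
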